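/- Conventions. Let $\mathcal A$ be a unital $*$-algebra over $\mathbb C$. A state of $\mathcal A$ is a linear functional $\omega:\mathcal A\to\mathbb C$ with $\omega(1)=1$ and $\omega(a^*a)\ge 0$ for all $a\in\mathcal A$. We say that the states of $\mathcal A$ separate points if, for $x\in\mathcal A$, $\omega(x^*x)=0$ for all states $\omega$ of $\mathcal A$ implies $x=0$. For a unit vector $\xi$ of a Hilbert space $H$, the vector state at $\xi$ is the functional $T\mapsto\langle T\xi,\xi\rangle$ on $\mathbb B(H)$. Unital subalgebras $\mathcal B_\alpha,\mathcal B_\beta$ of a unital algebra $\mathcal B$ with functionals $\varphi,\psi$ are conditionally free (c. free) with respect to $(\varphi,\psi)$ if for all $n\ge 2$, all indices $\kappa_1\ne\kappa_2\ne\cdots\ne\kappa_n$ in $\{\alpha,\beta\}$ (neighbours distinct) and all $a_i\in\mathcal B_{\kappa_i}$ with $\psi(a_i)=0$ for all $i$, one has $\varphi(a_1\cdots a_n)=\varphi(a_1)\cdots\varphi(a_n)$. They are free with respect to $\psi$ if for all such $n$, $\kappa_i$ and $a_i$ with $\psi(a_i)=0$ for all $i$, one has $\psi(a_1\cdots a_n)=0$.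 Theorem. Let $\mathcal A$ be a unital $*$-algebra over $\mathbb C$ with two states $\varphi,\psi$. Assume that $\mathcal A$ is the linear span of its unitaries and that $\varphi$ is not a unital $*$-homomorphism. Let $\mathcal A_\alpha,\mathcal A_\beta\subset\mathcal A$ be unital $*$-subalgebras that are conditionally free with respect to $(\varphi,\psi)$. Then there are a Hilbert space $H$, unit vectors $\xi,\tilde\eta\in H$ and unital $*$-representations $\rho_\alpha,\rho_\beta:\mathcal A\to\mathbb B(H)$, both injective on $\mathcal A$ whenever the states of $\mathcal A$ separate points (for instance if $\mathcal A$ is a $C^*$-algebra, or if $\varphi$ or $\psi$ is faithful), such that: 1. for all $a\in\mathcal A_\alpha$ and $b\in\mathcal A_\beta$, $$\varphi(a)=\langle\rho_\alpha(a)\xi,\xi\rangle,\quad \varphi(b)=\langle\rho_\beta(b)\xi,\xi\rangle,\quad \psi(a)=\langle\rho_\alpha(a)\tilde\eta,\tilde\eta\rangle,\quad \psi(b)=\langle\rho_\beta(b)\tilde\eta,\tilde\eta\rangle;$$ 2. $\rho_\alpha(\mathcal A_\alpha)$ and $\rho_\beta(\mathcal A_\beta)$ are conditionally free with respect to the pair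 formed by the vector states at $\xi$ and at $\tilde\eta$; 3. $\rho_\alpha(\mathcal A_\alpha)$ and $\rho_\beta(\mathcal A_\beta)$ are free with respect to the vector state at $\tilde\eta$. -/

import Mathlib

universe u

/-- A state of a unital complex `*`-algebra: a linear functional with `φ 1 = 1` and
`φ (a* a) ≥ 0` for every `a`, i.e. `φ (a* a)` is real and nonnegative. -/
structure IsState {A : Type*} [Ring A] [StarRing A] [Algebra ℂ A]
    (φ : A →ₗ[ℂ] ℂ) : Prop where
  map_one : φ 1 = 1
  nonneg : ∀ a : A, 0 ≤ (φ (star a * a)).re ∧ (φ (star a * a)).im = 0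

/-- `κ₁ ≠ κ₂ ≠ ⋯ ≠ κₙ`: neighbouring indices are distinct. -/
def Alternating {F : Type*} {n : ℕ} (κ : Fin n → F) : Prop :=
  ∀ (i : ℕ) (h : i + 1 < n), κ ⟨i, Nat.lt_of_succ_lt h⟩ ≠ κ ⟨i + 1, h⟩

/-- Conditional freeness of a family of unital subalgebras with respect to `(φ, ψ)`.
`(List.ofFn a).prod` is the ordered product `a₁ a₂ ⋯ aₙ`. -/
def CondFree {A : Type*} [Ring A] [Algebra ℂ A] (φ ψ : A →ₗ[ℂ] ℂ)
    {F : Type*} (S : F → Subalgebra ℂ A) : Prop :=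
  ∀ n : ℕ, 2 ≤ n → ∀ κ : Fin n → F, Alternating κ →
    ∀ a : Fin n → A, (∀ i, a i ∈ S (κ i)) → (∀ i, ψ (a i) = 0) →
      φ (List.ofFn a).prod = ∏ i, φ (a i)

/-- Free independence of a family of unital subalgebras with respect to `φ`. -/
def FreeIndep {A : Type*} [Ring A] [Algebra ℂ A] (φ : A →ₗ[ℂ] ℂ)
    {F : Type*} (S : F → Subalgebra ℂ A) : Prop :=
  ∀ n : ℕ, 2 ≤ n → ∀ κ : Fin n → F, Alternating κ →
    ∀ a : Fin n → A, (∀ i, a i ∈ S (κ i)) → (∀ i, φ (a i) = 0) →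
      φ (List.ofFn a).prod = 0

/-- The vector functional `T ↦ ⟨T ξ, ξ⟩` on the bounded operators of `H`. Mathlib's inner product
`innerSL ℂ x y` is linear in its second argument `y`, hence the order of the arguments. -/
noncomputable def vectorState {H : Type*} [NormedAddCommGroup H] [InnerProductSpace ℂ H] (ξ : H) :
    (H →L[ℂ] H) →ₗ[ℂ] ℂ where
  toFun T := innerSL ℂ ξ (T ξ)
  map_add' S T := by simp [inner_add_right]
  map_smul' c T := by simp [inner_smul_right]

/-- The states of the unital `*`-algebra `A` separate its points: only `x = 0` satisfies
`ω (x* x) = 0` for every state `ω`. -/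
def StatesSeparate (A : Type*) [Ring A] [StarRing A] [Algebra ℂ A] : Prop :=
  ∀ x : A, (∀ ω : A →ₗ[ℂ] ℂ, IsState ω → ω (star x * x) = 0) → x = 0

/-!
The two representations come from a Fock-type construction. Let `P` and `Q` be the GNS
representations of states `φ` and `ψ`, each with a Hilbert basis extending its cyclic unit vector,
and let `C` and `B` index the remaining basis vectors. On the Hilbert space with orthonormal basis
the words in two alternating colours, with letters in `B` except for the last one, which lies in
`C`, the words can be regrouped for each colour `i` (`splitWord`): the empty word and the one-letter
words of colour `i` form a copy of `P`, and each word `w` that begins with the other colour,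
together with its prolongations `b w` by a letter of colour `i`, forms a copy of `Q`. So the algebra
acts once for each colour (`wordRep`). An element with `ψ a = 0` acting through colour `i` carries
words that begin with the other colour to combinations of words that begin with `i`, and every `a`
carries the empty word to `φ a` times itself plus words that begin with `i`
(`isCFreeVector_wordRep`). By induction along an alternating product of `ψ`-centred elements, the
empty word has conditionally free moments for `(φ, ψ)` (`IsCFreeVector.prod_apply_sub_mem`). For
`φ = ψ` this is freeness.

The Hilbert space of the theorem is the Hilbert sum of these word spaces over all pairs of states:
`ξ` is the empty word of the summand `(φ, ψ)` and `η` that of the summand `(ψ, ψ)`. Every state is a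
vector state of the sum, which gives injectivity when states separate points. Completion of the left
multiplications and the Hilbert sums need bounds on `‖π a‖` that do not depend on the representation
`π`; these hold because `a` is a linear combination of unitaries (`PreGNS.exists_bound`,
`exists_norm_rep_le`).
-/

open UniformSpace

universe v

/-! ### The GNS representation of a `*`-algebra spanned by its unitaries -/

section GNS

variable {A : Type u} [Ring A] [StarRing A] [Algebra ℂ A]

theorem IsState.map_star [StarModule ℂ A] {ω : A →ₗ[ℂ] ℂ} (hω : IsState ω) (x : A) :
    ω (star x) = star (ω x) := by
  have h1 := (hω.nonneg x).2
  -- Polarization: `ω (y* y)` is real for `y = 1 + x` and for `y = 1 + i x`.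
  have h2 := (hω.nonneg (1 + x)).2
  have h3 := (hω.nonneg (1 + Complex.I • x)).2
  simp only [star_add, star_one, add_mul, mul_add, one_mul, mul_one, map_add, hω.map_one,
    star_smul, smul_mul_assoc, mul_smul_comm, map_smul, Complex.add_im,
    Complex.one_im, h1] at h2 h3
  simp at h3 h2
  apply Complex.ext
  · simp; linarith
  · simp; linarith

theorem IsState.map_star_mul [StarModule ℂ A] {ω : A →ₗ[ℂ] ℂ} (hω : IsState ω) (x y : A) :
    star (ω (star y * x)) = ω (star x * y) := by
  rw [← hω.map_star, star_mul, star_star]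

/-- The algebra `A`, regarded as the domain of the semi-inner product `⟪a, b⟫ = ω (a* b)`
attached to a state `ω`. -/
@[nolint unusedArguments]
def PreGNS {ω : A →ₗ[ℂ] ℂ} (_ : IsState ω) : Type u := A

namespace PreGNS

variable {ω : A →ₗ[ℂ] ℂ} (hω : IsState ω)

instance : AddCommGroup (PreGNS hω) := inferInstanceAs (AddCommGroup A)
instance : Module ℂ (PreGNS hω) := inferInstanceAs (Module ℂ A)

/-- The identity map from the algebra to its copy carrying the semi-inner product. -/
def of : A ≃ₗ[ℂ] PreGNS hω := LinearEquiv.refl ℂ A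

@[elab_as_elim]
theorem ind {p : PreGNS hω → Prop} (of_mem : ∀ b, p (of hω b)) (x : PreGNS hω) : p x :=
  of_mem ((of hω).symm x)

variable [StarModule ℂ A]

/-- The semi-inner product `⟪a, b⟫ = ω (a* b)`. -/
noncomputable abbrev core : PreInnerProductSpace.Core ℂ (PreGNS hω) where
  inner a b := ω (star ((of hω).symm a) * (of hω).symm b)
  conj_inner_symm a b := hω.map_star_mul _ _
  re_inner_nonneg a := (hω.nonneg ((of hω).symm a)).1
  add_left _ _ _ := by rw [_root_.map_add, star_add, add_mul, _root_.map_add]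
  smul_left _ _ _ := by simp

noncomputable instance : SeminormedAddCommGroup (PreGNS hω) :=
  InnerProductSpace.Core.toSeminormedAddCommGroup (c := core hω)

noncomputable instance : InnerProductSpace ℂ (PreGNS hω) :=
  InnerProductSpace.ofCore (core hω)

theorem inner_of (a b : A) : inner ℂ (of hω a) (of hω b) = ω (star a * b) := rfl

theorem norm_sq_of (a : A) : ‖of hω a‖ ^ 2 = (ω (star a * a)).re := by
  rw [← inner_of, ← inner_self_eq_norm_sq (𝕜 := ℂ)]; rfl

/-- Left multiplication by a unitary preserves the seminorm, so left multiplication by a linear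
combination of unitaries is bounded. -/
theorem exists_bound (hspan : Submodule.span ℂ (unitary A : Set A) = ⊤) (a : A) :
    ∃ C : ℝ, ∀ b : A, ‖of hω (a * b)‖ ≤ C * ‖of hω b‖ := by
  have ha : a ∈ Submodule.span ℂ (unitary A : Set A) := hspan ▸ Submodule.mem_top
  induction ha using Submodule.span_induction with
  | mem u hu =>
    refine ⟨1, fun b => le_of_eq ?_⟩
    rw [one_mul, ← sq_eq_sq₀ (norm_nonneg _) (norm_nonneg _), norm_sq_of, norm_sq_of, star_mul,
      mul_assoc, ← mul_assoc (star u), Unitary.star_mul_self_of_mem hu, one_mul]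
  | zero => exact ⟨0, fun b => by simp⟩
  | add x y _ _ hx hy =>
    obtain ⟨C, hC⟩ := hx
    obtain ⟨D, hD⟩ := hy
    refine ⟨C + D, fun b => ?_⟩
    rw [add_mul, add_mul, _root_.map_add]
    exact (norm_add_le _ _).trans (add_le_add (hC b) (hD b))
  | smul c x _ hx =>
    obtain ⟨C, hC⟩ := hx
    refine ⟨‖c‖ * C, fun b => ?_⟩
    rw [smul_mul_assoc, map_smul, norm_smul, mul_assoc]
    exact mul_le_mul_of_nonneg_left (hC b) (norm_nonneg c)

/-- Left multiplication by `a` as a bounded operator. -/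
noncomputable def leftMul (hspan : Submodule.span ℂ (unitary A : Set A) = ⊤) (a : A) :
    PreGNS hω →L[ℂ] PreGNS hω :=
  ((of hω).toLinearMap ∘ₗ LinearMap.mulLeft ℂ a ∘ₗ (of hω).symm.toLinearMap).mkContinuous
    (exists_bound hω hspan a).choose fun _ => (exists_bound hω hspan a).choose_spec _

@[simp]
theorem leftMul_apply (hspan : Submodule.span ℂ (unitary A : Set A) = ⊤) (a b : A) :
    leftMul hω hspan a (of hω b) = of hω (a * b) := rfl

end PreGNS

variable [StarModule ℂ A] {ω : A →ₗ[ℂ] ℂ} (hω : IsState ω)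

/-- The GNS representation, by left multiplication on the Hilbert space completion. -/
noncomputable def gnsRep (hspan : Submodule.span ℂ (unitary A : Set A) = ⊤) :
    A →⋆ₐ[ℂ] (Completion (PreGNS hω) →L[ℂ] Completion (PreGNS hω)) where
  toFun a := (PreGNS.leftMul hω hspan a).completion
  map_one' := by
    ext c
    induction c using Completion.induction_on with
    | hp => apply isClosed_eq <;> fun_prop
    | ih c => induction c using PreGNS.ind with | of_mem b => simp
  map_mul' x y := by
    ext c
    induction c using Completion.induction_on with
    | hp => apply isClosed_eq <;> fun_prop
    | ih c => induction c using PreGNS.ind with | of_mem b => simp [mul_assoc]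
  map_zero' := by
    ext c
    induction c using Completion.induction_on with
    | hp => apply isClosed_eq <;> fun_prop
    | ih c => induction c using PreGNS.ind with | of_mem b => simp; exact Completion.coe_zero
  map_add' x y := by
    ext c
    induction c using Completion.induction_on with
    | hp => apply isClosed_eq <;> fun_prop
    | ih c => induction c using PreGNS.ind with | of_mem b => simp [add_mul, Completion.coe_add]
  commutes' r := by
    ext c
    induction c using Completion.induction_on with
    | hp => apply isClosed_eq <;> fun_prop
    | ih c =>
      induction c using PreGNS.ind with | of_mem b => simp [Algebra.algebraMap_eq_smul_one]
  map_star' a := by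
    refine (ContinuousLinearMap.eq_adjoint_iff _ _).mpr fun x y => ?_
    induction x, y using Completion.induction_on₂ with
    | hp => apply isClosed_eq <;> fun_prop
    | ih x y =>
      induction x using PreGNS.ind with | of_mem b =>
      induction y using PreGNS.ind with | of_mem c =>
      simp [PreGNS.inner_of, mul_assoc]

theorem inner_gnsRep (hspan : Submodule.span ℂ (unitary A : Set A) = ⊤) (a : A) :
    inner ℂ (PreGNS.of hω 1 : Completion (PreGNS hω))
      (gnsRep hω hspan a (PreGNS.of hω 1 : Completion (PreGNS hω))) = ω a := by
  simp [gnsRep, PreGNS.inner_of]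

end GNS

/-! ### Hilbert bases -/

section Bases

/-- A unit vector belongs to a Hilbert basis; the index `none` is reserved for it. -/
theorem exists_hilbertBasis_option {E : Type u} [NormedAddCommGroup E] [InnerProductSpace ℂ E]
    [CompleteSpace E] {ξ : E} (hξ : ‖ξ‖ = 1) :
    ∃ (ι : Type u) (b : HilbertBasis (Option ι) ℂ E), b none = ξ := by
  classical
  have hs : Orthonormal ℂ ((↑) : ({ξ} : Set E) → E) :=
    ⟨fun x => by rw [x.2]; exact hξ, fun x y hxy => (hxy (Subsingleton.elim x y)).elim⟩
  obtain ⟨w, b, hw, hb⟩ := hs.exists_hilbertBasis_extension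
  let i₀ : w := ⟨ξ, hw rfl⟩
  let e := Equiv.optionSubtypeNe i₀
  have hv : Orthonormal ℂ (b ∘ e) := b.orthonormal.comp e e.injective
  refine ⟨{i : w // i ≠ i₀}, HilbertBasis.mk hv ?_, ?_⟩
  · rw [e.surjective.range_comp, b.dense_span]
  · rw [HilbertBasis.coe_mk]
    simp [e, i₀, hb]

theorem HilbertBasis.eq_zero_of_inner {ι E : Type*} [NormedAddCommGroup E]
    [InnerProductSpace ℂ E] (b : HilbertBasis ι ℂ E) {x : E} (h : ∀ i, inner ℂ (b i) x = 0) :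
    x = 0 := by
  refine b.repr.injective ?_
  ext i
  simp [HilbertBasis.repr_apply_apply, h]

theorem HilbertBasis.exists_eq_smul_none {ι E : Type*} [NormedAddCommGroup E]
    [InnerProductSpace ℂ E] (b : HilbertBasis (Option ι) ℂ E) {x : E}
    (h : ∀ i, inner ℂ (b (some i)) x = 0) : ∃ z : ℂ, x = z • b none := by
  refine ⟨inner ℂ (b none) x, sub_eq_zero.1 (b.eq_zero_of_inner fun i => ?_)⟩
  rw [inner_sub_right, inner_smul_right]
  rcases i with _ | i
  · rw [inner_self_eq_norm_sq_to_K, b.orthonormal.1]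
    simp
  · rw [h, b.orthonormal.2 (Option.some_ne_none i), mul_zero, sub_zero]

variable {J : Type*} {G : J → Type*} [∀ j, NormedAddCommGroup (G j)]
  [∀ j, InnerProductSpace ℂ (G j)] [∀ j, CompleteSpace (G j)]

open Classical in
/-- Hilbert bases `b j` of the summands give a Hilbert basis of the Hilbert sum. It is indexed
through a bijection `e` by an arbitrary type `W`. -/
theorem exists_hilbertBasis_lp {W : Type*} {κ : J → Type*} (b : ∀ j, HilbertBasis (κ j) ℂ (G j))
    (e : W ≃ Σ j, κ j) :
    ∃ B : HilbertBasis W ℂ (lp G 2), ∀ w, B w = lp.single 2 (e w).1 (b (e w).1 (e w).2) := by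
  have ho : Orthonormal ℂ fun p : Σ j, κ j => (lp.single 2 p.1 (b p.1 p.2) : lp G 2) := by
    refine ⟨fun p => ?_, ?_⟩
    · rw [lp.norm_single (by norm_num)]
      exact (b p.1).orthonormal.1 p.2
    · rintro ⟨j, x⟩ ⟨k, y⟩ hne
      rw [lp.inner_single_left]
      by_cases hjk : j = k
      · subst hjk
        rw [lp.single_apply_self]
        exact (b j).orthonormal.2 fun h => hne (congrArg (Sigma.mk j) h)
      · rw [lp.single_apply_ne 2 k _ hjk, inner_zero_right]
  have hv := ho.comp e e.injective
  refine ⟨HilbertBasis.mkOfOrthogonalEqBot hv ?_, fun w => ?_⟩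
  · rw [e.surjective.range_comp, Submodule.eq_bot_iff]
    intro f hf
    ext j : 2
    refine (b j).eq_zero_of_inner fun x => ?_
    have := (Submodule.mem_orthogonal _ _).1 hf _ (Submodule.subset_span ⟨⟨j, x⟩, rfl⟩)
    rw [lp.inner_single_left] at this
    exact this
  · rw [HilbertBasis.coe_mkOfOrthogonalEqBot]; rfl

end Bases

/-! ### Hilbert sums of representations -/

section DirectSum

variable {A : Type u} [Ring A] [StarRing A] [Algebra ℂ A]

/-- Unitaries act as contractions, so a linear combination of unitaries is bounded uniformly in
the representation. -/
theorem exists_norm_rep_le (hspan : Submodule.span ℂ (unitary A : Set A) = ⊤) (a : A) :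
    ∃ C : ℝ, 0 ≤ C ∧ ∀ (H : Type v) [NormedAddCommGroup H] [InnerProductSpace ℂ H]
      [CompleteSpace H] (π : A →⋆ₐ[ℂ] (H →L[ℂ] H)), ‖π a‖ ≤ C := by
  have ha : a ∈ Submodule.span ℂ (unitary A : Set A) := hspan ▸ Submodule.mem_top
  induction ha using Submodule.span_induction with
  | mem u hu =>
    refine ⟨1, zero_le_one, fun H _ _ _ π => ?_⟩
    have h : ‖π u‖ * ‖π u‖ ≤ 1 := by
      rw [← CStarRing.norm_star_mul_self, ← map_star, ← map_mul,
        Unitary.star_mul_self_of_mem hu, map_one]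
      exact ContinuousLinearMap.norm_id_le
    nlinarith [norm_nonneg (π u)]
  | zero => exact ⟨0, le_rfl, fun H _ _ _ π => by simp⟩
  | add x y _ _ hx hy =>
    obtain ⟨C, hC0, hC⟩ := hx
    obtain ⟨D, hD0, hD⟩ := hy
    refine ⟨C + D, add_nonneg hC0 hD0, fun H _ _ _ π => ?_⟩
    rw [map_add]
    exact (norm_add_le _ _).trans (add_le_add (hC H π) (hD H π))
  | smul c x _ hx =>
    obtain ⟨C, hC0, hC⟩ := hx
    refine ⟨‖c‖ * C, by positivity, fun H _ _ _ π => ?_⟩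
    rw [map_smul, norm_smul]
    exact mul_le_mul_of_nonneg_left (hC H π) (norm_nonneg c)

variable {J : Type*} {G : J → Type v} [∀ j, NormedAddCommGroup (G j)]
  [∀ j, InnerProductSpace ℂ (G j)] [∀ j, CompleteSpace (G j)]

/-- The Hilbert sum of a family of representations, acting coordinatewise. -/
noncomputable def directSumRep (hspan : Submodule.span ℂ (unitary A : Set A) = ⊤)
    (π : ∀ j, A →⋆ₐ[ℂ] (G j →L[ℂ] G j)) : A →⋆ₐ[ℂ] (lp G 2 →L[ℂ] lp G 2) where
  toFun a := lp.mapCLM 2 (fun j => π j a) (exists_norm_rep_le.{u, v} hspan a).choose_spec.1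
    fun j => (exists_norm_rep_le.{u, v} hspan a).choose_spec.2 (G j) (π j)
  map_one' := by ext; simp
  map_mul' x y := by ext; simp
  map_zero' := by ext; simp
  map_add' x y := by ext; simp
  commutes' r := by ext; simp [Algebra.algebraMap_eq_smul_one]
  map_star' a := by
    refine (ContinuousLinearMap.eq_adjoint_iff _ _).mpr fun x y => ?_
    rw [lp.inner_eq_tsum, lp.inner_eq_tsum]
    refine tsum_congr fun j => ?_
    simp [map_star, ContinuousLinearMap.star_eq_adjoint, ContinuousLinearMap.adjoint_inner_left]

@[simp]
theorem directSumRep_apply (hspan : Submodule.span ℂ (unitary A : Set A) = ⊤)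
    (π : ∀ j, A →⋆ₐ[ℂ] (G j →L[ℂ] G j)) (a : A) (f : lp G 2) (j : J) :
    directSumRep hspan π a f j = π j a (f j) := rfl

theorem directSumRep_single [DecidableEq J]
    (hspan : Submodule.span ℂ (unitary A : Set A) = ⊤)
    (π : ∀ j, A →⋆ₐ[ℂ] (G j →L[ℂ] G j)) (a : A) (j : J) (x : G j) :
    directSumRep hspan π a (lp.single 2 j x) = lp.single 2 j (π j a x) := by
  ext k
  rw [directSumRep_apply]
  by_cases hkj : k = j
  · subst hkj; simp
  · rw [lp.single_apply_ne 2 j _ hkj, lp.single_apply_ne 2 j _ hkj, map_zero]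

end DirectSum

/-! ### Vectors with conditionally free moments -/

section CFreeVector

variable {A : Type u} [Ring A] [StarRing A] [Algebra ℂ A] {F : Type*}
  {H : Type v} [NormedAddCommGroup H] [InnerProductSpace ℂ H] [CompleteSpace H]

/-- The geometric source of conditional freeness. The subspace `X i ⟂ ξ` stands for the words whose
leading letter has index `i`: an element acting through `ρ i` sends `ξ` to `φ a • ξ` up to a word
of `X i`, and, if it is centred for `ψ`, it prolongs every word that begins with another index to a
word that begins with `i`. -/
structure IsCFreeVector (φ ψ : A →ₗ[ℂ] ℂ) (ρ : F → A →⋆ₐ[ℂ] (H →L[ℂ] H)) (ξ : H)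
    (X : F → Submodule ℂ H) : Prop where
  norm_eq_one : ‖ξ‖ = 1
  inner_eq_zero : ∀ i, ∀ x ∈ X i, inner ℂ ξ x = 0
  apply_sub_mem : ∀ i a, ρ i a ξ - φ a • ξ ∈ X i
  apply_mem : ∀ i j, i ≠ j → ∀ a, ψ a = 0 → ∀ x ∈ X j, ρ i a x ∈ X i

namespace IsCFreeVector

variable {φ ψ : A →ₗ[ℂ] ℂ} {ρ : F → A →⋆ₐ[ℂ] (H →L[ℂ] H)} {ξ : H} {X : F → Submodule ℂ H}

/-- A vector that splits as `c • ξ` plus a vector orthogonal to `ξ` has `ξ`-component `c`. -/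
theorem inner_eq (h : IsCFreeVector φ ψ ρ ξ X) {i : F} {y : H} {c : ℂ}
    (hy : y - c • ξ ∈ X i) : inner ℂ ξ y = c := by
  have := h.inner_eq_zero i _ hy
  rw [inner_sub_right, inner_smul_right, inner_self_eq_norm_sq_to_K, h.norm_eq_one] at this
  simpa [sub_eq_zero] using this

theorem vectorState_apply (h : IsCFreeVector φ ψ ρ ξ X) (i : F) (a : A) :
    vectorState ξ (ρ i a) = φ a :=
  h.inner_eq (h.apply_sub_mem i a)

/-- An alternating product of `ψ`-centred elements sends `ξ` to the expected multiple of `ξ` up to a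
word that begins with the index of the leftmost factor. -/
theorem prod_apply_sub_mem (h : IsCFreeVector φ ψ ρ ξ X) (n : ℕ) (κ : Fin (n + 1) → F)
    (hκ : Alternating κ) (a : Fin (n + 1) → A) (ha : ∀ i, ψ (a i) = 0) :
    (List.ofFn fun i => ρ (κ i) (a i)).prod ξ - (∏ i, φ (a i)) • ξ ∈ X (κ 0) := by
  induction n with
  | zero => simpa using h.apply_sub_mem (κ 0) (a 0)
  | succ n ih =>
    have ih' := ih (fun i => κ i.succ) (fun i hi => hκ (i + 1) (by omega))
      (fun i => a i.succ) fun i => ha i.succ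
    rw [List.ofFn_succ, List.prod_cons, Fin.prod_univ_succ, mul_apply_eq_comp]
    set y := (List.ofFn fun i : Fin (n + 1) => ρ (κ i.succ) (a i.succ)).prod ξ
    set c := ∏ i : Fin (n + 1), φ (a i.succ)
    have hne : κ 0 ≠ κ (Fin.succ 0) := hκ 0 (by omega)
    -- The first factor acts separately on the two terms of `y = (y - c • ξ) + c • ξ`.
    have key : ρ (κ 0) (a 0) y - (φ (a 0) * c) • ξ
        = ρ (κ 0) (a 0) (y - c • ξ) + c • (ρ (κ 0) (a 0) ξ - φ (a 0) • ξ) := by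
      rw [map_sub, map_smul, smul_sub, smul_smul, mul_comm c]
      abel
    rw [key]
    exact (X _).add_mem (h.apply_mem _ _ hne _ (ha 0) _ ih')
      ((X _).smul_mem _ (h.apply_sub_mem _ _))

theorem vectorState_prod (h : IsCFreeVector φ ψ ρ ξ X) {n : ℕ} (hn : 0 < n) (κ : Fin n → F)
    (hκ : Alternating κ) (a : Fin n → A) (ha : ∀ i, ψ (a i) = 0) :
    vectorState ξ (List.ofFn fun i => ρ (κ i) (a i)).prod = ∏ i, φ (a i) := by
  obtain ⟨n, rfl⟩ := Nat.exists_eq_succ_of_ne_zero hn.ne'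
  exact h.inner_eq (h.prod_apply_sub_mem n κ hκ a ha)

variable {η : H} {Y : F → Submodule ℂ H} {S : F → Subalgebra ℂ (H →L[ℂ] H)}

theorem condFree (h : IsCFreeVector φ ψ ρ ξ X) (h' : IsCFreeVector ψ ψ ρ η Y)
    (hS : ∀ i, ∀ T ∈ S i, ∃ a, ρ i a = T) : CondFree (vectorState ξ) (vectorState η) S := by
  intro n hn κ hκ T hT hT0
  choose a ha using fun i => hS (κ i) (T i) (hT i)
  obtain rfl : (fun i => ρ (κ i) (a i)) = T := funext ha
  rw [h.vectorState_prod (by omega) κ hκ a fun i => by rw [← hT0 i, h'.vectorState_apply]]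
  exact Finset.prod_congr rfl fun i _ => (h.vectorState_apply _ _).symm

/-- Freeness is conditional freeness for a pair of equal functionals. -/
theorem freeIndep (h' : IsCFreeVector ψ ψ ρ η Y)
    (hS : ∀ i, ∀ T ∈ S i, ∃ a, ρ i a = T) : FreeIndep (vectorState η) S := by
  intro n hn κ hκ T hT hT0
  rw [h'.condFree h' hS n hn κ hκ T hT hT0]
  exact Finset.prod_eq_zero (Finset.mem_univ ⟨0, by omega⟩) (hT0 _)

/-- The property passes from one summand to a Hilbert sum of representations. -/
theorem directSum {J : Type*} [DecidableEq J] {G : J → Type v} [∀ j, NormedAddCommGroup (G j)]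
    [∀ j, InnerProductSpace ℂ (G j)] [∀ j, CompleteSpace (G j)]
    (hspan : Submodule.span ℂ (unitary A : Set A) = ⊤)
    {ρ : ∀ j, F → A →⋆ₐ[ℂ] (G j →L[ℂ] G j)} {j : J} {ξ : G j} {X : F → Submodule ℂ (G j)}
    (h : IsCFreeVector φ ψ (ρ j) ξ X) :
    IsCFreeVector φ ψ (fun i => directSumRep hspan fun j => ρ j i) (lp.single 2 j ξ)
      fun i => (X i).map (lp.lsingle (𝕜 := ℂ) (E := G) 2 j) where
  norm_eq_one := by rw [lp.norm_single (by norm_num), h.norm_eq_one]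
  inner_eq_zero := by
    rintro i _ ⟨x, hx, rfl⟩
    rw [lp.inner_single_left]
    simpa using h.inner_eq_zero i x hx
  apply_sub_mem i a := by
    refine ⟨_, h.apply_sub_mem i a, ?_⟩
    rw [directSumRep_single, map_sub, map_smul]
    rfl
  apply_mem := by
    rintro i k hik a ha _ ⟨x, hx, rfl⟩
    refine ⟨_, h.apply_mem i k hik a ha x hx, ?_⟩
    exact (directSumRep_single hspan (fun j => ρ j i) a j x).symm

end IsCFreeVector

end CFreeVector

/-! ### The conditionally free product of two pointed representations -/

section Product

variable (A : Type u) [Ring A] [StarRing A] [Algebra ℂ A]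

/-- A representation on a Hilbert space with a distinguished unit vector `basis none`, which is
completed to a Hilbert basis. -/
structure PointedRep where
  H : Type u
  [normed : NormedAddCommGroup H]
  [innerProductSpace : InnerProductSpace ℂ H]
  [complete : CompleteSpace H]
  rep : A →⋆ₐ[ℂ] (H →L[ℂ] H)
  ι : Type u
  basis : HilbertBasis (Option ι) ℂ H

attribute [instance] PointedRep.normed PointedRep.innerProductSpace PointedRep.complete

variable {A}

/-- The functional on the algebra given by the distinguished vector. -/
noncomputable def PointedRep.state (P : PointedRep A) (a : A) : ℂ :=
  inner ℂ (P.basis none) (P.rep a (P.basis none))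

theorem PointedRep.inner_basis_none (P : PointedRep A) :
    inner ℂ (P.basis none) (P.basis none) = 1 := by
  rw [inner_self_eq_norm_sq_to_K, P.basis.orthonormal.1]
  simp

theorem IsState.exists_pointedRep [StarModule ℂ A]
    (hspan : Submodule.span ℂ (unitary A : Set A) = ⊤) {ω : A →ₗ[ℂ] ℂ} (hω : IsState ω) :
    ∃ P : PointedRep A, ∀ a, P.state a = ω a := by
  let ζ : UniformSpace.Completion (PreGNS hω) := (PreGNS.of hω 1 : PreGNS hω)
  have hζ : ‖ζ‖ = 1 := by
    rw [UniformSpace.Completion.norm_coe, ← sq_eq_sq₀ (norm_nonneg _) zero_le_one,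
      PreGNS.norm_sq_of]
    simp [hω.map_one]
  obtain ⟨ι, b, hb⟩ := exists_hilbertBasis_option hζ
  refine ⟨⟨_, gnsRep hω hspan, ι, b⟩, fun a => ?_⟩
  simp only [PointedRep.state, hb]
  exact inner_gnsRep hω hspan a

/-- Words in letters of two alternating colours: the empty word `none`, or `some (i, l, c)`, which
stands for the word with letters `l` in `B` followed by a last letter `c` in `C`, where the leading
letter has colour `i`. Colours alternate, so `i` determines them all. -/
abbrev AltWord (B C : Type u) : Type u := Option (Fin 2 × List B × C)

variable (P Q : PointedRep A)

/-- The summands in the decomposition of the word space under the action of one colour: `P` for the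
empty word, and a copy of `Q` for each word that begins with the other colour. -/
def wordSummand : Option (List Q.ι × P.ι) → PointedRep A
  | none => P
  | some _ => Q

/-- Splitting off the leading letter if it has colour `i`. A word with another leading colour is
read as the distinguished vector of `Q` followed by the word. -/
def splitWord (i : Fin 2) : AltWord Q.ι P.ι ≃ Σ k, Option (wordSummand P Q k).ι where
  toFun
    | none => ⟨none, none⟩
    | some (j, l, c) =>
      if j = i then
        match l with
        | [] => ⟨none, some c⟩
        | b :: l => ⟨some (l, c), some b⟩
      else ⟨some (l, c), none⟩
  -- `i.rev` is the colour other than `i`.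
  invFun
    | ⟨none, none⟩ => none
    | ⟨none, some c⟩ => some (i, [], c)
    | ⟨some (l, c), some b⟩ => some (i, b :: l, c)
    | ⟨some k, none⟩ => some (i.rev, k)
  left_inv := by
    have hrev : ∀ i j : Fin 2, ¬ j = i → i.rev = j := by decide
    rintro (_ | ⟨j, _ | ⟨b, l⟩, c⟩)
    · rfl
    all_goals
      by_cases hj : j = i
      · subst hj; simp
      · simp [hj, hrev i j hj]
  right_inv := by
    have hrev : ∀ i : Fin 2, ¬ i.rev = i := by decide
    rintro ⟨_ | ⟨l, c⟩, _ | b⟩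
    · rfl
    · simp
    · simp [hrev]
    · simp

/-- The Hilbert space with orthonormal basis the alternating words. -/
abbrev WordSpace : Type u := lp (fun _ : AltWord Q.ι P.ι => ℂ) 2

/-- The closed span of the words with leading colour `i`. -/
def wordsFrom (i : Fin 2) : Submodule ℂ (WordSpace P Q) where
  carrier := {f | f none = 0 ∧ ∀ j k, j ≠ i → f (some (j, k)) = 0}
  zero_mem' := by simp
  add_mem' := by
    rintro f g ⟨hf, hf'⟩ ⟨hg, hg'⟩
    exact ⟨by simp [hf, hg], fun j k hj => by simp [hf' j k hj, hg' j k hj]⟩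
  smul_mem' := by
    rintro c f ⟨hf, hf'⟩
    exact ⟨by simp [hf], fun j k hj => by simp [hf' j k hj]⟩

/-- The Hilbert basis of the `i`-th decomposition, indexed by words. -/
noncomputable def wordBasis (i : Fin 2) :
    HilbertBasis (AltWord Q.ι P.ι) ℂ (lp (fun k => (wordSummand P Q k).H) 2) :=
  (exists_hilbertBasis_lp (fun k => (wordSummand P Q k).basis) (splitWord P Q i)).choose

theorem wordBasis_apply [DecidableEq (Option (List Q.ι × P.ι))] (i : Fin 2) (w : AltWord Q.ι P.ι) :
    wordBasis P Q i w = lp.single 2 (splitWord P Q i w).1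
      ((wordSummand P Q (splitWord P Q i w).1).basis (splitWord P Q i w).2) := by
  unfold wordBasis
  convert (exists_hilbertBasis_lp (fun k => (wordSummand P Q k).basis)
    (splitWord P Q i)).choose_spec w

theorem wordBasis_repr_apply (i : Fin 2) (g : lp (fun k => (wordSummand P Q k).H) 2)
    {w : AltWord Q.ι P.ι} {k : Option (List Q.ι × P.ι)} {x : Option (wordSummand P Q k).ι}
    (hw : splitWord P Q i w = ⟨k, x⟩) :
    (wordBasis P Q i).repr g w = inner ℂ ((wordSummand P Q k).basis x) (g k) := by
  classical
  rw [HilbertBasis.repr_apply_apply, wordBasis_apply, hw, lp.inner_single_left]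

theorem splitWord_none (i : Fin 2) : splitWord P Q i none = ⟨none, none⟩ := rfl

theorem splitWord_singleton (i : Fin 2) (c : P.ι) :
    splitWord P Q i (some (i, [], c)) = ⟨none, some c⟩ := by
  simp [splitWord]

theorem splitWord_cons (i : Fin 2) (b : Q.ι) (l : List Q.ι) (c : P.ι) :
    splitWord P Q i (some (i, b :: l, c)) = ⟨some (l, c), some b⟩ := by
  simp [splitWord]

theorem splitWord_of_ne {i j : Fin 2} (hij : j ≠ i) (k : List Q.ι × P.ι) :
    splitWord P Q i (some (j, k)) = ⟨some k, none⟩ := by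
  simp [splitWord, hij]

/-- The action of colour `i` on the word space, transported along `splitWord`: through `P` on the
span of the empty word and of the one-letter words of colour `i`, and through `Q` on the leading
letter of the remaining words, a missing letter of colour `i` being the distinguished vector. -/
noncomputable def wordRep (hspan : Submodule.span ℂ (unitary A : Set A) = ⊤) (i : Fin 2) :
    A →⋆ₐ[ℂ] (WordSpace P Q →L[ℂ] WordSpace P Q) :=
  (StarAlgHomClass.toStarAlgHom (wordBasis P Q i).repr.conjStarAlgEquiv).comp
    (directSumRep hspan fun k => (wordSummand P Q k).rep)

theorem wordRep_repr (hspan : Submodule.span ℂ (unitary A : Set A) = ⊤) (i : Fin 2) (a : A)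
    (g : lp (fun k => (wordSummand P Q k).H) 2) :
    wordRep P Q hspan i a ((wordBasis P Q i).repr g) =
      (wordBasis P Q i).repr (directSumRep hspan (fun k => (wordSummand P Q k).rep) a g) := by
  simp [wordRep]

/-- The empty word is a conditionally free vector. -/
theorem isCFreeVector_wordRep [DecidableEq (AltWord Q.ι P.ι)]
    (hspan : Submodule.span ℂ (unitary A : Set A) = ⊤)
    {φ ψ : A →ₗ[ℂ] ℂ} (hP : ∀ a, P.state a = φ a) (hQ : ∀ a, Q.state a = ψ a) :
    IsCFreeVector φ ψ (wordRep P Q hspan) (lp.single 2 none 1) (wordsFrom P Q) where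
  norm_eq_one := by rw [lp.norm_single (by norm_num), norm_one]
  inner_eq_zero i x hx := by
    rw [lp.inner_single_left, hx.1, inner_zero_right]
  apply_sub_mem i a := by
    classical
    rw [← (wordBasis P Q i).repr_self, wordRep_repr, wordBasis_apply, splitWord_none,
      directSumRep_single hspan (fun k => (wordSummand P Q k).rep), ← map_smul, ← map_sub,
      ← lp.single_smul, ← lp.single_sub]
    refine ⟨?_, fun j k hj => ?_⟩
    · rw [wordBasis_repr_apply P Q i _ (splitWord_none P Q i)]
      rw [lp.single_apply_self, inner_sub_right, inner_smul_right]
      refine sub_eq_zero.2 ((hP a).trans ?_)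
      exact ((congrArg (φ a * ·) P.inner_basis_none).trans (mul_one _)).symm
    · rw [wordBasis_repr_apply P Q i _ (splitWord_of_ne P Q hj k),
        lp.single_apply_ne 2 _ _ (Option.some_ne_none k), inner_zero_right]
  apply_mem i j hij a ha f hf := by
    obtain ⟨g, rfl⟩ := (wordBasis P Q i).repr.surjective f
    rw [wordRep_repr]
    obtain ⟨hf0, hf1⟩ := hf
    refine ⟨?_, fun j' k hj' => ?_⟩
    · rw [wordBasis_repr_apply P Q i _ (splitWord_none P Q i), directSumRep_apply]
      -- The coordinates of `g none` are those of `f` at the empty word and at one-letter words of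
      -- colour `i`, none of which begins with `j`.
      have hg : g none = 0 := by
        refine P.basis.eq_zero_of_inner fun x => ?_
        rcases x with _ | c
        · exact (wordBasis_repr_apply P Q i g (splitWord_none P Q i)).symm.trans hf0
        · exact (wordBasis_repr_apply P Q i g (splitWord_singleton P Q i c)).symm.trans
            (hf1 i _ hij)
      rw [hg, map_zero, inner_zero_right]
    · rw [wordBasis_repr_apply P Q i _ (splitWord_of_ne P Q hj' k), directSumRep_apply]
      -- The component at `k` is a multiple of the distinguished vector `ζ`, and `⟪ζ, a ζ⟫ = ψ a`.
      obtain ⟨z, hz⟩ : ∃ z : ℂ, g (some k) = z • (wordSummand P Q (some k)).basis none := by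
        refine Q.basis.exists_eq_smul_none fun b => ?_
        exact (wordBasis_repr_apply P Q i g (splitWord_cons P Q i b k.1 k.2)).symm.trans
          (hf1 i _ hij)
      rw [hz, map_smul, inner_smul_right]
      exact mul_eq_zero_of_right z ((hQ a).trans ha)

end Product

/-! ### The representations on the sum over all pairs of states -/

theorem mainTheorem1 {A : Type u} [Ring A] [StarRing A] [Algebra ℂ A] [StarModule ℂ A]
    (φ ψ : A →ₗ[ℂ] ℂ) (hφ : IsState φ) (hψ : IsState ψ)
    (hspan : Submodule.span ℂ (unitary A : Set A) = ⊤)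
    (hnot : ¬ ∃ f : A →⋆ₐ[ℂ] ℂ, ∀ x, f x = φ x)
    (Aα Aβ : StarSubalgebra ℂ A)
    (hfree : CondFree φ ψ ![Aα.toSubalgebra, Aβ.toSubalgebra]) :
    ∃ (H : Type u) (_ : NormedAddCommGroup H) (_ : InnerProductSpace ℂ H) (_ : CompleteSpace H)
      (ξ η : H) (ρα ρβ : A →⋆ₐ[ℂ] (H →L[ℂ] H)),
      ‖ξ‖ = 1 ∧ ‖η‖ = 1 ∧
      (StatesSeparate A → Function.Injective ρα ∧ Function.Injective ρβ) ∧
      (∀ a ∈ Aα, φ a = vectorState ξ (ρα a) ∧ ψ a = vectorState η (ρα a)) ∧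
      (∀ b ∈ Aβ, φ b = vectorState ξ (ρβ b) ∧ ψ b = vectorState η (ρβ b)) ∧
      CondFree (vectorState ξ) (vectorState η)
        ![(Aα.map ρα).toSubalgebra, (Aβ.map ρβ).toSubalgebra] ∧
      FreeIndep (vectorState η)
        ![(Aα.map ρα).toSubalgebra, (Aβ.map ρβ).toSubalgebra] := by
  classical
  choose R hR using fun ω : {ω : A →ₗ[ℂ] ℂ // IsState ω} => ω.2.exists_pointedRep hspan
  let J := {ω : A →ₗ[ℂ] ℂ // IsState ω} × {ω : A →ₗ[ℂ] ℂ // IsState ω}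
  -- Summing over all pairs of states makes the representation as faithful as states allow.
  let σ : ∀ p : J, Fin 2 → A →⋆ₐ[ℂ] (WordSpace (R p.1) (R p.2) →L[ℂ] WordSpace (R p.1) (R p.2)) :=
    fun p => wordRep (R p.1) (R p.2) hspan
  let ρ := fun i => directSumRep hspan fun p : J => σ p i
  let vac : ∀ p : J, lp (fun p : J => WordSpace (R p.1) (R p.2)) 2 :=
    fun p => lp.single 2 p (lp.single 2 none 1)
  have hvac (p : J) : IsCFreeVector p.1.1 p.2.1 ρ (vac p) _ :=
    (isCFreeVector_wordRep (R p.1) (R p.2) hspan (hR p.1) (hR p.2)).directSum (ρ := σ) hspan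
  have hξ := hvac (⟨φ, hφ⟩, ⟨ψ, hψ⟩)
  have hη := hvac (⟨ψ, hψ⟩, ⟨ψ, hψ⟩)
  have hinj (hsep : StatesSeparate A) (i : Fin 2) : Function.Injective (ρ i) := by
    refine (injective_iff_map_eq_zero _).2 fun x hx => hsep x fun ω hω => ?_
    rw [← (hvac (⟨ω, hω⟩, ⟨ω, hω⟩)).vectorState_apply i, map_mul, hx, mul_zero, map_zero]
  have hS : ∀ i, ∀ T ∈ (![(Aα.map (ρ 0)).toSubalgebra, (Aβ.map (ρ 1)).toSubalgebra] :
      Fin 2 → Subalgebra ℂ _) i, ∃ a, ρ i a = T := by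
    intro i T hT
    fin_cases i <;> obtain ⟨a, -, ha⟩ := hT <;> exact ⟨a, ha⟩
  exact ⟨_, _, _, inferInstance, _, _, ρ 0, ρ 1, hξ.norm_eq_one, hη.norm_eq_one,
    fun hsep => ⟨hinj hsep 0, hinj hsep 1⟩,
    fun a _ => ⟨(hξ.vectorState_apply 0 a).symm, (hη.vectorState_apply 0 a).symm⟩,
    fun b _ => ⟨(hξ.vectorState_apply 1 b).symm, (hη.vectorState_apply 1 b).symm⟩,
    hξ.condFree hη hS, hη.freeIndep hS⟩
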